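/- Let $R$ be an associative ring with identity and let $M$ be a unitary right $R$-module. Let $E(M)$ be an injective hull of $M$, and let $\widehat{M}=\sum_{\varphi\in\operatorname{Hom}_R(M,E(M))}\varphi(M)\subseteq E(M)$ be the trace of $M$ in $E(M)$. Consider the following conditions. (1) $\widehat{M}$ is abelian endoregular, i.e. the ring $\operatorname{End}_R(\widehat{M})$ is von Neumann regular and all its idempotents are central. (2) $M$ is polyform (for every submodule $K\le M$ and every nonzero homomorphism $\varphi:K\to M$, $\ker\varphi$ is not essential in $K$); every essentially closed submodule of $M$ is fully invariant; and $\operatorname{End}_R(M)$ is a reduced ring. Here a submodule $N\le M$ is essentially closed if $L=N$ whenever $N\le L\le M$ and $N$ is essential in $L$, and $N$ is fully invariant if $\varphi(N)\subseteq N$ for all $\varphi\in\operatorname{End}_R(M)$. Then (1) implies (2). Moreover, if $M$ is retractable, that is, $\operatorname{Hom}_R(M,N)\neq 0$ for every nonzero submodule $N\le M$, then (2) implies (1). -/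

import Mathlib

universe u v

namespace AbelianEndoregular

section Rings

variable (S : Type*) [Ring S]

/-- `S` is von Neumann regular: every `a` is of the form `a x a`. -/
def IsVonNeumannRegular : Prop := ∀ a : S, ∃ x : S, a * x * a = a

/-- `S` is abelian: every idempotent is central. -/
def IsAbelian : Prop := ∀ e : S, IsIdempotentElem e → ∀ a : S, e * a = a * e

end Rings

section Modules

variable (R : Type*) [Ring R] (M : Type*) [AddCommGroup M] [Module R M]

/-- The endomorphism ring of `M` is an abelian von Neumann regular ring. -/
def IsAbelianEndoregular : Prop :=
  IsVonNeumannRegular (Module.End R M) ∧ IsAbelian (Module.End R M)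

variable {R M} in
/-- `N` is essential in `M`: it meets every nonzero submodule of `M` nontrivially. -/
def IsEssential (N : Submodule R M) : Prop := ∀ L : Submodule R M, L ≠ ⊥ → N ⊓ L ≠ ⊥

variable {R M} in
/-- `N` has no proper essential extension inside `M`. -/
def IsEssentiallyClosed (N : Submodule R M) : Prop :=
  ∀ L : Submodule R M, N ≤ L → IsEssential (N.submoduleOf L) → L = N

/-- No nonzero homomorphism from a submodule `K` of `M` to `M` has a kernel essential in `K`. -/
def IsPolyform : Prop :=
  ∀ (K : Submodule R M) (φ : K →ₗ[R] M), φ ≠ 0 → ¬ IsEssential (LinearMap.ker φ)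

/-- There is a nonzero homomorphism from `M` to each nonzero submodule of `M`. -/
def IsRetractable : Prop := ∀ N : Submodule R M, N ≠ ⊥ → ∃ φ : M →ₗ[R] N, φ ≠ 0

/-- The trace of `M` in `E`: the sum of the images of all homomorphisms from `M` to `E`. -/
def trace (E : Type*) [AddCommGroup E] [Module R E] : Submodule R E :=
  ⨆ φ : M →ₗ[R] E, LinearMap.range φ

end Modules

section Hull

variable {R : Type u} [Ring R] {M : Type v} [AddCommGroup M] [Module R M]

/-- `E`, with the embedding `ι`, is an injective hull of `M`: `E` is injective and is an essential
extension of the image of `M`. The universe of `E` contains that of `R`, so that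
`Module.Injective R E` is injectivity with respect to all `R`-modules. -/
structure IsInjectiveHull {E : Type (max u v)} [AddCommGroup E] [Module R E]
    (ι : M →ₗ[R] E) : Prop where
  injective : Module.Injective R E
  embedding : Function.Injective ι
  essential : IsEssential (LinearMap.range ι)


/-- Every module has an injective hull. -/
theorem exists_isInjectiveHull (R : Type u) [Ring R] (M : Type v) [AddCommGroup M] [Module R M] :
    ∃ (E : Type (max u v)) (_ : AddCommGroup E) (_ : Module R E) (ι : M →ₗ[R] E),
      IsInjectiveHull ι := by
  obtain ⟨I, _, _, f, hI, hf⟩ : ∃ (I : Type (max u v)) (_ : AddCommGroup I) (_ : Module R I)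
      (f : M →ₗ[R] I), Module.Injective R I ∧ Function.Injective f := by
    obtain ⟨P⟩ := (inferInstance : CategoryTheory.EnoughInjectives
      (ModuleCat.{max u v} R)).presentation (ModuleCat.of R (ULift.{u} M))
    have hP : CategoryTheory.Injective (ModuleCat.of R P.J) := P.injective
    exact ⟨P.J, inferInstance, inferInstance, P.f.hom ∘ₗ ULift.moduleEquiv.symm.toLinearMap,
      Module.injective_module_of_injective_object R P.J,
      ((ModuleCat.mono_iff_injective P.f).mp P.mono).comp ULift.moduleEquiv.symm.injective⟩
  -- a maximal essential extension `E` of the image of `M` inside `I`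
  let S : Set (Submodule R I) :=
    {L | LinearMap.range f ≤ L ∧ ∀ X ≤ L, X ≠ ⊥ → LinearMap.range f ⊓ X ≠ ⊥}
  obtain ⟨E, -, hE⟩ := zorn_le_nonempty₀ S (by
    intro c hc hch y hy
    refine ⟨sSup c, ⟨(hc hy).1.trans (le_sSup hy), ?_⟩, fun z hz => le_sSup hz⟩
    intro X hX hX0 h
    obtain ⟨x, hx, hx0⟩ := X.ne_bot_iff.mp hX0
    obtain ⟨L, hL, hxL⟩ :=
      (Submodule.mem_sSup_of_directed ⟨y, hy⟩ hch.directedOn).mp (hX hx)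
    refine (hc hL).2 (Submodule.span R {x}) (by simpa [Submodule.span_le] using hxL)
      (by simpa using hx0) ?_
    rw [eq_bot_iff, ← h]
    exact inf_le_inf_left _ (by simpa [Submodule.span_le] using hx)) (LinearMap.range f)
    ⟨le_rfl, fun X hX hX0 => by rwa [inf_eq_right.mpr hX]⟩
  have hES := hE.prop
  -- a submodule `C` maximal with `C ⊓ E = ⊥`
  obtain ⟨C, -, hC⟩ := zorn_le_nonempty₀ {C : Submodule R I | Disjoint C E} (by
    intro c hc hch y hy
    refine ⟨sSup c, ?_, fun z hz => le_sSup hz⟩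
    refine Submodule.disjoint_def.mpr fun x hx hxE => ?_
    obtain ⟨L, hL, hxL⟩ := (Submodule.mem_sSup_of_directed ⟨y, hy⟩ hch.directedOn).mp hx
    exact Submodule.disjoint_def.mp (hc hL) x hxL hxE) ⊥ disjoint_bot_left
  have hCE : Disjoint C E := hC.prop
  -- extend `E → I` along `E → I ⧸ C`
  obtain ⟨g, hg⟩ := hI.out (C.mkQ ∘ₗ E.subtype) (by
    rw [← LinearMap.ker_eq_bot, LinearMap.ker_comp, Submodule.ker_mkQ, eq_bot_iff]
    intro x hx
    exact Subtype.ext (Submodule.disjoint_def.mp hCE x hx x.2)) E.subtype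
  have hg' : ∀ x ∈ E, g (C.mkQ x) = x := fun x hx => hg ⟨x, hx⟩
  have hginj : LinearMap.ker g = ⊥ := by
    let D := (LinearMap.ker g).comap C.mkQ
    have hCD : C ≤ D := by
      intro x hx
      have : C.mkQ x = 0 := by simpa using hx
      simp [D, this]
    have hDE : Disjoint D E := Submodule.disjoint_def.mpr fun x hx hxE => by
      rw [← hg' x hxE]; exact hx
    have hDC : D ≤ C := hC.le_of_ge hDE hCD
    rw [eq_bot_iff]
    intro y hy
    obtain ⟨x, rfl⟩ := C.mkQ_surjective y
    simpa using hDC (show x ∈ D from hy)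
  have hErange : E ≤ LinearMap.range g := fun x hx => ⟨_, hg' x hx⟩
  have hrange : LinearMap.range g ≤ E := by
    refine hE.le_of_ge ⟨hES.1.trans hErange, fun X hX hX0 h => ?_⟩ hErange
    refine hES.2 (E ⊓ X) inf_le_left (fun h0 => ?_) ?_
    · -- `X` pulls back to a submodule disjoint from `E` and containing `C`
      let D := (X.comap g).comap C.mkQ
      have hCD : C ≤ D := by
        intro x hx
        have : C.mkQ x = 0 := by simpa using hx
        simp [D, this]
      have hDE : Disjoint D E := Submodule.disjoint_def.mpr fun x hx hxE => by
        have h1 : g (C.mkQ x) ∈ X := hx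
        rw [hg' x hxE] at h1
        have : x ∈ E ⊓ X := ⟨hxE, h1⟩
        simpa [h0] using this
      have hDC : D ≤ C := hC.le_of_ge hDE hCD
      apply hX0
      rw [eq_bot_iff]
      intro z hz
      obtain ⟨y, rfl⟩ := hX hz
      obtain ⟨x, rfl⟩ := C.mkQ_surjective y
      have : C.mkQ x = 0 := by simpa using hDC (show x ∈ D from hz)
      simp [this]
    · rw [eq_bot_iff, ← h]
      exact inf_le_inf_left _ inf_le_right
  let p : I →ₗ[R] E := (g ∘ₗ C.mkQ).codRestrict E fun x => hrange ⟨_, rfl⟩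
  have hp : ∀ x : E, p x = x := fun x => Subtype.ext (hg' x x.2)
  refine ⟨E, inferInstance, inferInstance, f.codRestrict E fun x => hES.1 ⟨x, rfl⟩, ⟨?_⟩, ?_, ?_⟩
  · intro X Y _ _ _ _ i hi k
    obtain ⟨h, hh⟩ := hI.out i hi (E.subtype ∘ₗ k)
    exact ⟨p ∘ₗ h, fun x => by simp [hh, hp]⟩
  · intro x y hxy
    exact hf (congrArg Subtype.val hxy)
  · intro L hL h
    refine hES.2 (L.map E.subtype) (Submodule.map_subtype_le E L) (fun h0 => hL ?_) ?_
    · exact Submodule.map_injective_of_injective E.injective_subtype (h0.trans (Submodule.map_bot _).symm)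
    · rw [eq_bot_iff]
      rintro _ ⟨⟨m, rfl⟩, x, hx, hxm⟩
      have : x ∈ LinearMap.range (f.codRestrict E fun x => hES.1 ⟨x, rfl⟩) ⊓ L :=
        ⟨⟨m, Subtype.ext hxm.symm⟩, hx⟩
      rw [h, Submodule.mem_bot] at this
      rw [← hxm, this]; simp

end Hull

end AbelianEndoregular

/-!
Write `T` for the trace of `M` in its injective hull `E`. Three facts about `T` carry the proof:
it contains `M` as an essential submodule; it is quasi-injective, because every endomorphism of `E`
maps `T` to itself (`isQuasiInjective_trace`); and it is generated by the images of the
homomorphisms `M → T` (`eq_zero_of_forall_comp_eq_zero`).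

A module is called *K-nonsingular* if it has no nonzero endomorphism with essential kernel. If
`End T` is von Neumann regular then `T` is K-nonsingular (`IsVonNeumannRegular.isKNonsingular`), and
for quasi-injective `T` this passes to homomorphisms `K → T` defined on any `K` that embeds in `T`,
by extending them by zero on a complement of `K`; hence `M` is polyform. If `N` is essentially
closed in `M` and `C` is a complement of `N` in `M`, the projection `N ⊕ C → N` extends to an
endomorphism `e` of `T`, which is idempotent by K-nonsingularity and satisfies `N = M ∩ eT`.
Since `e` is central and endomorphisms of `M` extend to `T`, `N` is fully invariant. Finally
`End M` is reduced because a nilpotent endomorphism of `M` extends to a nilpotent one of `T`.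

Conversely, let `M` be polyform. A homomorphism to `T` from a submodule of `M` vanishes if its
kernel is essential (`IsPolyform.eq_zero_of_isEssential_ker`). As `T` is generated by `M`, it is
K-nonsingular, and a quasi-injective K-nonsingular module has von Neumann regular endomorphism ring
(`IsQuasiInjective.isVonNeumannRegular_end`): a partial inverse of `f`, defined on the image of a
complement of `ker f`, extends to `T`. For every endomorphism `g` of `T`, the submodule `M ∩ ker g`
is essentially closed in `M`, hence fully invariant. Now let `e` be an idempotent of `End T`, and
put `N = M ∩ eT` and `N' = M ∩ (1 - e)T`, so that `N ⊕ N'` is essential in `M`. If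
`h = (1 - e) f e` were nonzero, it would embed some nonzero `K ≤ N` into `N'`. Retractability gives a
nonzero `φ : M → K`. It kills `N'`, which is fully invariant and meets `K ≤ N` trivially; and it
kills `N`, since `h φ` is an endomorphism of `M` with image in `N'` and so kills `N`. Thus `φ`
vanishes on an essential submodule, contradicting polyformity. Hence `(1 - e) f e = 0` for all `e`
and `f`, and idempotents are central.
-/

namespace AbelianEndoregular

/-! ### Essential submodules -/

section Essential

variable {A : Type*} [Ring A] {M : Type*} [AddCommGroup M] [Module A M]
  {T : Type*} [AddCommGroup T] [Module A T]

theorem isEssential_iff {N : Submodule A M} :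
    IsEssential N ↔ ∀ x : M, x ≠ 0 → ∃ r : A, r • x ∈ N ∧ r • x ≠ 0 := by
  constructor
  · intro h x hx
    obtain ⟨y, ⟨hyN, hyx⟩, hy⟩ := (Submodule.ne_bot_iff _).mp (h (A ∙ x) (by simpa using hx))
    obtain ⟨r, rfl⟩ := Submodule.mem_span_singleton.mp hyx
    exact ⟨r, hyN, hy⟩
  · intro h L hL
    obtain ⟨x, hxL, hx⟩ := L.ne_bot_iff.mp hL
    obtain ⟨r, hrN, hr⟩ := h x hx
    exact (Submodule.ne_bot_iff _).mpr ⟨r • x, ⟨hrN, L.smul_mem r hxL⟩, hr⟩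

theorem IsEssential.mono {N L : Submodule A M} (hN : IsEssential N) (h : N ≤ L) :
    IsEssential L := fun X hX h0 =>
  hN X hX (eq_bot_iff.mpr (h0 ▸ inf_le_inf_right X h))

theorem IsEssential.comap {N : Submodule A T} (hN : IsEssential N) (f : M →ₗ[A] T) :
    IsEssential (N.comap f) := by
  rw [isEssential_iff] at hN ⊢
  intro x hx
  by_cases hfx : f x = 0
  · exact ⟨1, by simp [hfx], by simpa using hx⟩
  · obtain ⟨r, hr, hr0⟩ := hN (f x) hfx
    exact ⟨r, by simpa using hr, fun h => hr0 (by rw [← map_smul, h, map_zero])⟩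

/-- Essential extensions compose, along an injective `j : M → T`. -/
theorem IsEssential.map {N : Submodule A M} (hN : IsEssential N) {j : M →ₗ[A] T}
    (hj : Function.Injective j) (hess : IsEssential (LinearMap.range j)) :
    IsEssential (N.map j) := by
  rw [isEssential_iff] at hN hess ⊢
  intro x hx
  obtain ⟨r, ⟨m, hm⟩, hr⟩ := hess x hx
  obtain ⟨s, hs, hs0⟩ := hN m (by rintro rfl; exact hr (by simpa using hm.symm))
  refine ⟨s * r, ?_, ?_⟩
  · rw [mul_smul, ← hm, ← map_smul]
    exact Submodule.mem_map_of_mem hs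
  · rw [mul_smul, ← hm, ← map_smul]
    exact fun h => hs0 (hj (h.trans (map_zero j).symm))

/-- Every submodule has a complement for the intersection, and their sum is essential. -/
theorem exists_disjoint_isEssential_sup (K : Submodule A M) :
    ∃ C : Submodule A M, Disjoint K C ∧ IsEssential (K ⊔ C) := by
  obtain ⟨C, -, hC⟩ := zorn_le_nonempty₀ {C : Submodule A M | Disjoint K C} (by
    intro c hc hch y hy
    exact ⟨sSup c, hch.directedOn.disjoint_sSup_right.mpr fun _ h => hc h,
      fun z hz => le_sSup hz⟩) ⊥ disjoint_bot_right
  refine ⟨C, hC.prop, fun L hL h => hL ?_⟩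
  -- `C ⊔ L` is again disjoint from `K`, so that `L ≤ C` by maximality
  have hd : Disjoint K (C ⊔ L) := Disjoint.disjoint_sup_right_of_disjoint_sup_left hC.prop
    (disjoint_iff.mpr h)
  have hLC : L ≤ C := le_sup_right.trans (hC.le_of_ge hd le_sup_left)
  rw [← h]
  exact (inf_eq_right.mpr (hLC.trans le_sup_right)).symm

end Essential

/-! ### Quasi-injective and K-nonsingular modules -/

section QuasiInjective

variable {A : Type*} [Ring A] {T : Type*} [AddCommGroup T] [Module A T]

variable (A T) in
/-- `T` is quasi-injective: every homomorphism from a submodule of `T` to `T` extends to an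
endomorphism of `T`. -/
def IsQuasiInjective : Prop :=
  ∀ (K : Submodule A T) (f : K →ₗ[A] T), ∃ g : Module.End A T, ∀ x : K, g x = f x

variable (A T) in
/-- `T` is K-nonsingular: only the zero endomorphism of `T` has an essential kernel. -/
def IsKNonsingular : Prop :=
  ∀ g : Module.End A T, IsEssential (LinearMap.ker g) → g = 0

theorem IsQuasiInjective.exists_extension (hT : IsQuasiInjective A T) {K : Type*} [AddCommGroup K]
    [Module A K] {i : K →ₗ[A] T} (hi : Function.Injective i) (f : K →ₗ[A] T) :
    ∃ g : Module.End A T, ∀ x, g (i x) = f x := by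
  obtain ⟨g, hg⟩ := hT (LinearMap.range i) (f ∘ₗ (LinearEquiv.ofInjective i hi).symm)
  refine ⟨g, fun x => ?_⟩
  have h := hg (LinearEquiv.ofInjective i hi x)
  simpa using h

theorem IsQuasiInjective.exists_extension_by_zero (hT : IsQuasiInjective A T) {K : Type*}
    [AddCommGroup K] [Module A K] {i : K →ₗ[A] T} (hi : Function.Injective i)
    {C : Submodule A T} (hC : Disjoint (LinearMap.range i) C) (f : K →ₗ[A] T) :
    ∃ g : Module.End A T, (∀ x, g (i x) = f x) ∧ ∀ c ∈ C, g c = 0 := by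
  have hinj : Function.Injective (i.coprod C.subtype) := by
    rw [← LinearMap.ker_eq_bot, LinearMap.ker_coprod_of_disjoint_range _ _ (by simpa using hC),
      LinearMap.ker_eq_bot.mpr hi, Submodule.ker_subtype, Submodule.prod_bot]
  obtain ⟨g, hg⟩ := hT.exists_extension hinj (f ∘ₗ LinearMap.fst A K C)
  refine ⟨g, fun x => by simpa using hg (x, 0), fun c hc => by simpa using hg (0, ⟨c, hc⟩)⟩

theorem IsVonNeumannRegular.isKNonsingular (h : IsVonNeumannRegular (Module.End A T)) :
    IsKNonsingular A T := by
  intro g hg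
  obtain ⟨x, hx⟩ := h g
  have hx' : ∀ y, g (x (g y)) = g y := fun y => LinearMap.congr_fun hx y
  ext y
  by_contra hy
  -- `xg` is idempotent with the same kernel as `g`, which therefore meets its image trivially
  obtain ⟨r, hr, hr0⟩ := isEssential_iff.mp hg (x (g y)) (fun h0 => hy (by
    rw [← hx' y, h0, map_zero, LinearMap.zero_apply]))
  refine hr0 ?_
  have : r • g y = 0 := by simpa [hx'] using hr
  rw [← map_smul, this, map_zero]

/-- K-nonsingularity of a quasi-injective `T` extends to homomorphisms `K → T` on any `K` that
embeds in `T`: such a homomorphism extends by zero to a complement of `K`. -/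
theorem IsQuasiInjective.eq_zero_of_isEssential_ker (hT : IsQuasiInjective A T)
    (hns : IsKNonsingular A T) {K : Type*} [AddCommGroup K] [Module A K] {i : K →ₗ[A] T}
    (hi : Function.Injective i) {f : K →ₗ[A] T} (hf : IsEssential (LinearMap.ker f)) : f = 0 := by
  obtain ⟨C, hdisj, hess⟩ := exists_disjoint_isEssential_sup (LinearMap.range i)
  obtain ⟨g, hgi, hgC⟩ := hT.exists_extension_by_zero hi hdisj f
  have hg : g = 0 := hns g <| isEssential_iff.mpr fun x hx => by
    obtain ⟨r, hr, hr0⟩ := isEssential_iff.mp hess x hx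
    obtain ⟨_, ⟨k, rfl⟩, c, hc, hkc⟩ := Submodule.mem_sup.mp hr
    by_cases hk : k = 0
    · exact ⟨r, by simp [LinearMap.mem_ker, ← hkc, hk, hgC c hc], hr0⟩
    · obtain ⟨s, hs, hs0⟩ := isEssential_iff.mp hf k hk
      refine ⟨s * r, ?_, fun h0 => hs0 (hi ?_)⟩
      · have hs' : s • f k = 0 := by simpa using hs
        rw [LinearMap.mem_ker, mul_smul, ← hkc, map_smul, map_add, hgi, hgC c hc, add_zero, hs']
      · rw [mul_smul, ← hkc, smul_add, ← map_smul] at h0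
        rw [map_zero]
        refine Submodule.disjoint_def.mp hdisj _ ⟨_, rfl⟩ ?_
        rw [eq_neg_of_add_eq_zero_left h0]
        exact C.neg_mem (C.smul_mem s hc)
  ext x
  rw [← hgi, hg, LinearMap.zero_apply, LinearMap.zero_apply]

theorem IsQuasiInjective.isVonNeumannRegular_end (hT : IsQuasiInjective A T)
    (hns : IsKNonsingular A T) : IsVonNeumannRegular (Module.End A T) := by
  intro f
  obtain ⟨C, hdisj, hess⟩ := exists_disjoint_isEssential_sup (LinearMap.ker f)
  have hinj : Function.Injective (f ∘ₗ C.subtype) := by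
    rw [← LinearMap.ker_eq_bot, eq_bot_iff]
    exact fun x hx => Subtype.ext (Submodule.disjoint_def.mp hdisj x hx x.2)
  -- `x` inverts `f` on the complement `C` of its kernel
  obtain ⟨x, hx⟩ := hT.exists_extension hinj C.subtype
  refine ⟨x, sub_eq_zero.mp (hns _ (hess.mono (sup_le ?_ ?_)))⟩
  · intro y hy
    have hy' : f y = 0 := hy
    simp [hy']
  · intro y hy
    have hy' : x (f y) = y := hx ⟨y, hy⟩
    simp [hy']

end QuasiInjective

/-! ### Abelian regular rings -/

theorem eq_zero_of_sq_eq_zero {S : Type*} [Ring S] (hreg : IsVonNeumannRegular S)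
    (hab : IsAbelian S) {a : S} (ha : a * a = 0) : a = 0 := by
  obtain ⟨x, hx⟩ := hreg a
  have he : IsIdempotentElem (a * x) := by
    rw [IsIdempotentElem, ← mul_assoc, hx]
  rw [← hx, hab _ he, ← mul_assoc, ha, zero_mul]

/-- Idempotents are central as soon as all Peirce corners `(1 - e) S e` vanish. -/
theorem isAbelian_of_one_sub_mul_mul_eq_zero {S : Type*} [Ring S]
    (h : ∀ e : S, IsIdempotentElem e → ∀ a : S, (1 - e) * a * e = 0) : IsAbelian S := by
  intro e he a
  have h1 : a * e - e * a * e = 0 := by simpa [sub_mul] using h e he a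
  have h2 : e * a - e * a * e = 0 := by
    simpa [mul_sub] using h (1 - e) he.one_sub a
  exact (sub_eq_zero.mp h2).trans (sub_eq_zero.mp h1).symm

/-! ### From the trace to the module -/

section Extension

variable {A : Type*} [Ring A] {M : Type*} [AddCommGroup M] [Module A M]
  {T : Type*} [AddCommGroup T] [Module A T] {j : M →ₗ[A] T}

theorem isPolyform_of_isQuasiInjective (hT : IsQuasiInjective A T) (hns : IsKNonsingular A T)
    (hj : Function.Injective j) : IsPolyform A M := by
  intro K φ hφ hess
  refine hφ ?_
  have h : j ∘ₗ φ = 0 := hT.eq_zero_of_isEssential_ker hns (i := j ∘ₗ K.subtype)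
    (hj.comp K.injective_subtype) (by rwa [LinearMap.ker_comp_of_ker_eq_bot _
      (LinearMap.ker_eq_bot.mpr hj)])
  ext x
  exact hj (by simpa using LinearMap.congr_fun h x)

/-- An endomorphism of `T` that vanishes on an essential submodule `M` is zero. -/
theorem IsKNonsingular.eq_zero_of_comp_eq_zero (hns : IsKNonsingular A T)
    (hess : IsEssential (LinearMap.range j)) {g : Module.End A T} (h : g ∘ₗ j = 0) : g = 0 :=
  hns g (hess.mono (LinearMap.range_le_ker_iff.mpr h))

theorem isReduced_end_of_isQuasiInjective (hT : IsQuasiInjective A T)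
    (hreg : IsVonNeumannRegular (Module.End A T)) (hab : IsAbelian (Module.End A T))
    (hj : Function.Injective j) (hess : IsEssential (LinearMap.range j)) :
    IsReduced (Module.End A M) := by
  rw [isReduced_iff_pow_one_lt 2 one_lt_two]
  intro f hf
  obtain ⟨g, hg⟩ := hT.exists_extension hj (j ∘ₗ f)
  have hff : ∀ x, f (f x) = 0 := fun x => by
    simpa [pow_two] using LinearMap.congr_fun hf x
  have hg0 : g = 0 := by
    refine eq_zero_of_sq_eq_zero hreg hab (hreg.isKNonsingular.eq_zero_of_comp_eq_zero hess ?_)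
    ext x
    simp [hg, hff]
  ext x
  exact hj (by simpa [hg0] using (hg x).symm)

/-- An essentially closed submodule of `M` is the intersection of `M` with a direct summand
`eT` of `T`. -/
theorem IsEssentiallyClosed.exists_isIdempotentElem (hT : IsQuasiInjective A T)
    (hns : IsKNonsingular A T) (hj : Function.Injective j)
    (hess : IsEssential (LinearMap.range j)) {N : Submodule A M} (hN : IsEssentiallyClosed N) :
    ∃ e : Module.End A T, IsIdempotentElem e ∧ ∀ x, x ∈ N ↔ e (j x) = j x := by
  obtain ⟨C, hdisj, hNC⟩ := exists_disjoint_isEssential_sup N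
  have hNC' := hNC.map hj hess
  obtain ⟨e, heN, heC⟩ := hT.exists_extension_by_zero (i := j ∘ₗ N.subtype)
    (hj.comp N.injective_subtype) (C := C.map j) (by
      rw [LinearMap.range_comp, Submodule.range_subtype]
      exact (Submodule.disjoint_map hj hdisj)) (j ∘ₗ N.subtype)
  have heN' : ∀ n ∈ N, e (j n) = j n := fun n hn => heN ⟨n, hn⟩
  have heC' : ∀ c ∈ C, e (j c) = 0 := fun c hc => heC _ ⟨c, hc, rfl⟩
  refine ⟨e, ?_, ?_⟩
  · refine sub_eq_zero.mp (hns _ (hNC'.mono ?_))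
    rw [Submodule.map_sup]
    refine sup_le ?_ ?_
    · rintro _ ⟨n, hn, rfl⟩
      simp [heN' n hn]
    · rintro _ ⟨c, hc, rfl⟩
      simp [heC' c hc]
  · -- `N` is essential in `M ∩ eT`: a nonzero `n + c` in `eT` equals `e (n + c) = n`
    let L : Submodule A M := LinearMap.ker ((e - 1) ∘ₗ j)
    have hL : ∀ x, x ∈ L ↔ e (j x) = j x := fun x => by simp [L, sub_eq_zero]
    have hLN : L = N := by
      refine hN L (fun n hn => (hL n).mpr (heN' n hn)) (isEssential_iff.mpr ?_)
      rintro ⟨x, hx⟩ hx0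
      obtain ⟨r, hr, hr0⟩ := isEssential_iff.mp hNC x (by simpa using hx0)
      obtain ⟨n, hn, c, hc, hnc⟩ := Submodule.mem_sup.mp hr
      have h1 := (hL _).mp (L.smul_mem r hx)
      rw [← hnc, map_add, map_add, heN' n hn, heC' c hc, add_zero, ← map_add] at h1
      refine ⟨r, ?_, fun h => hr0 (congrArg Subtype.val h)⟩
      change r • x ∈ N
      rwa [← hnc, ← hj h1]
    intro x
    rw [← hLN, hL]

theorem IsEssentiallyClosed.isFullyInvariant (hT : IsQuasiInjective A T)
    (hns : IsKNonsingular A T) (hab : IsAbelian (Module.End A T))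
    (hj : Function.Injective j) (hess : IsEssential (LinearMap.range j))
    {N : Submodule A M} (hN : IsEssentiallyClosed N) : N.IsFullyInvariant := by
  intro f n hn
  obtain ⟨e, he, heN⟩ := hN.exists_isIdempotentElem hT hns hj hess
  obtain ⟨g, hg⟩ := hT.exists_extension hj (j ∘ₗ f)
  have hg' : ∀ x, g (j x) = j (f x) := hg
  have hcomm : e (g (j n)) = g (e (j n)) := LinearMap.congr_fun (hab e he g) (j n)
  rw [(heN n).mp hn, hg'] at hcomm
  exact (heN _).mpr hcomm

end Extension

/-! ### From the module to the trace -/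

section Polyform

variable {A : Type*} [Ring A] {M : Type*} [AddCommGroup M] [Module A M]
  {T : Type*} [AddCommGroup T] [Module A T] {j : M →ₗ[A] T}

/-- If `M` is polyform and essential in `T`, then a homomorphism to `T` from a submodule `K` of `M`
vanishes as soon as its kernel is essential: its restriction to the preimage of `M` is zero, so its
image meets `M` trivially. -/
theorem IsPolyform.eq_zero_of_isEssential_ker (hM : IsPolyform A M) (hj : Function.Injective j)
    (hess : IsEssential (LinearMap.range j)) {K : Submodule A M} {ψ : K →ₗ[A] T}
    (hψ : IsEssential (LinearMap.ker ψ)) : ψ = 0 := by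
  by_contra hne
  let e := LinearEquiv.ofInjective j hj
  let P : Submodule A M := ((LinearMap.range j).comap ψ).map K.subtype
  have hPK : P ≤ K := Submodule.map_subtype_le _ _
  have hP : ∀ x : P, ψ (Submodule.inclusion hPK x) ∈ LinearMap.range j := by
    rintro ⟨_, y, hy, rfl⟩
    exact hy
  let φ : P →ₗ[A] M := e.symm.toLinearMap ∘ₗ (ψ ∘ₗ Submodule.inclusion hPK).codRestrict _ hP
  have hφ : ∀ x, j (φ x) = ψ (Submodule.inclusion hPK x) := fun x =>
    congrArg Subtype.val (e.apply_symm_apply ⟨_, hP x⟩)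
  have hker : LinearMap.ker φ = (LinearMap.ker ψ).comap (Submodule.inclusion hPK) := by
    ext x
    rw [Submodule.mem_comap, LinearMap.mem_ker, LinearMap.mem_ker, ← hφ,
      map_eq_zero_iff j hj]
  have hφ0 : φ = 0 := by
    by_contra h
    exact hM P φ h (hker ▸ hψ.comap _)
  obtain ⟨x, hx⟩ : ∃ x, ψ x ≠ 0 := by
    by_contra! h
    exact hne (LinearMap.ext h)
  obtain ⟨r, hr, hr0⟩ := isEssential_iff.mp hess _ hx
  rw [← map_smul] at hr hr0
  have h := hφ ⟨_, r • x, hr, rfl⟩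
  rw [hφ0, LinearMap.zero_apply, map_zero] at h
  exact hr0 h.symm

theorem IsPolyform.eq_zero_of_isEssential_ker_of_hom (hM : IsPolyform A M)
    (hj : Function.Injective j) (hess : IsEssential (LinearMap.range j)) {ψ : M →ₗ[A] T}
    (hψ : IsEssential (LinearMap.ker ψ)) : ψ = 0 := by
  have h : ψ ∘ₗ (⊤ : Submodule A M).subtype = 0 :=
    hM.eq_zero_of_isEssential_ker hj hess (by rw [LinearMap.ker_comp]; exact hψ.comap _)
  ext x
  exact LinearMap.congr_fun h ⟨x, trivial⟩

theorem IsPolyform.isKNonsingular (hM : IsPolyform A M) (hj : Function.Injective j)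
    (hess : IsEssential (LinearMap.range j))
    (hgen : ∀ g : Module.End A T, (∀ φ : M →ₗ[A] T, g ∘ₗ φ = 0) → g = 0) :
    IsKNonsingular A T := fun g hg => hgen g fun φ =>
  hM.eq_zero_of_isEssential_ker_of_hom hj hess (by rw [LinearMap.ker_comp]; exact hg.comap φ)

theorem IsPolyform.isEssentiallyClosed_ker (hM : IsPolyform A M) (hj : Function.Injective j)
    (hess : IsEssential (LinearMap.range j)) (ψ : M →ₗ[A] T) :
    IsEssentiallyClosed (LinearMap.ker ψ) := by
  intro L hle hL
  have h : ψ ∘ₗ L.subtype = 0 := hM.eq_zero_of_isEssential_ker hj hess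
    (by rw [LinearMap.ker_comp]; exact hL)
  exact le_antisymm (fun x hx => LinearMap.congr_fun h ⟨x, hx⟩) hle

/-- `(M ∩ eT) ⊕ (M ∩ (1 - e)T)` is essential in `M` for every idempotent `e` of `End T`. -/
theorem isEssential_ker_sup_ker
    (hess : IsEssential (LinearMap.range j)) {e : Module.End A T} (he : IsIdempotentElem e) :
    IsEssential (LinearMap.ker ((1 - e) ∘ₗ j) ⊔ LinearMap.ker (e ∘ₗ j)) := by
  have hee : ∀ t, e (e t) = e t := LinearMap.congr_fun he
  -- elements `x` with both `e x` and `(1 - e) x` in `M` form an essential submodule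
  have h := (hess.comap (e ∘ₗ j))
  rw [isEssential_iff] at h ⊢
  intro x hx
  obtain ⟨r, ⟨m, hm⟩, hr⟩ := h x hx
  refine ⟨r, ?_, hr⟩
  have hm' : j m = e (j (r • x)) := hm
  rw [← add_sub_cancel m (r • x)]
  refine Submodule.add_mem_sup ?_ ?_
  · simp [hm', hee]
  · simp [hm', hee]

/-- The key step of the converse: for an idempotent `e` of `End T`, the corner
`(1 - e) (End T) e` is zero. -/
theorem IsPolyform.one_sub_mul_mul_eq_zero (hM : IsPolyform A M) (hret : IsRetractable A M)
    (hclosed : ∀ N : Submodule A M, IsEssentiallyClosed N → N.IsFullyInvariant)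
    (hj : Function.Injective j) (hess : IsEssential (LinearMap.range j))
    (hns : IsKNonsingular A T) {e : Module.End A T} (he : IsIdempotentElem e)
    (f : Module.End A T) : (1 - e) * f * e = 0 := by
  have hsum := isEssential_ker_sup_ker hess he
  have hinvN := hclosed _ (hM.isEssentiallyClosed_ker hj hess ((1 - e) ∘ₗ j))
  have hinvN' := hclosed _ (hM.isEssentiallyClosed_ker hj hess (e ∘ₗ j))
  have hmemN : ∀ x, x ∈ LinearMap.ker ((1 - e) ∘ₗ j) ↔ e (j x) = j x := fun x => by
    simp [sub_eq_zero, eq_comm (a := e (j x))]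
  have hmemN' : ∀ x, x ∈ LinearMap.ker (e ∘ₗ j) ↔ e (j x) = 0 := fun x => by simp
  set N := LinearMap.ker ((1 - e) ∘ₗ j)
  set N' := LinearMap.ker (e ∘ₗ j)
  have hNN' : ∀ x ∈ N, x ∈ N' → x = 0 := fun x hx hx' => hj (by
    rw [← (hmemN x).mp hx, (hmemN' x).mp hx', map_zero])
  have hdef : ∀ t, ((1 - e) * f * e) t = f (e t) - e (f (e t)) := fun t => by simp
  have heh : ∀ t, e (((1 - e) * f * e) t) = 0 := fun t => by
    have hee : ∀ t, e (e t) = e t := LinearMap.congr_fun he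
    rw [hdef, map_sub, hee, sub_self]
  set h := (1 - e) * f * e
  by_contra hne
  -- `h` does not vanish on `N`, since it vanishes on `N'` and `N ⊔ N'` is essential
  have hN0 : h ∘ₗ j ∘ₗ N.subtype ≠ 0 := by
    intro h0
    refine hne (hns.eq_zero_of_comp_eq_zero hess
      (hM.eq_zero_of_isEssential_ker_of_hom hj hess (hsum.mono (sup_le ?_ ?_))))
    · exact fun x hx => LinearMap.congr_fun h0 ⟨x, hx⟩
    · intro x hx
      rw [LinearMap.mem_ker, LinearMap.comp_apply, hdef, (hmemN' x).mp hx]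
      simp
  -- hence `h` is injective on a nonzero submodule of `N`
  have hker : ¬ IsEssential (LinearMap.ker (h ∘ₗ j ∘ₗ N.subtype)) := fun hk =>
    hN0 (hM.eq_zero_of_isEssential_ker hj hess hk)
  simp only [IsEssential, not_forall, not_not] at hker
  obtain ⟨K₁, hK₁, hinj⟩ := hker
  -- shrink it to a submodule `K` that `h` maps into `M`
  let K : Submodule A M := (K₁ ⊓ (LinearMap.range j).comap (h ∘ₗ j ∘ₗ N.subtype)).map N.subtype
  have hK : K ≠ ⊥ := by
    rw [Ne, ← Submodule.map_bot N.subtype,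
      (Submodule.map_injective_of_injective N.injective_subtype).eq_iff, inf_comm]
    exact hess.comap _ _ hK₁
  have hKN : K ≤ N := Submodule.map_subtype_le _ _
  have hKM : ∀ x ∈ K, h (j x) ∈ LinearMap.range j := by
    rintro _ ⟨y, hy, rfl⟩
    exact hy.2
  have hKinj : ∀ x ∈ K, h (j x) = 0 → x = 0 := by
    rintro _ ⟨y, hy, rfl⟩ hy0
    have hy' : y ∈ LinearMap.ker (h ∘ₗ j ∘ₗ N.subtype) ⊓ K₁ := ⟨hy0, hy.1⟩
    rw [hinj, Submodule.mem_bot] at hy'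
    rw [hy', map_zero]
  obtain ⟨φ, hφ⟩ := hret K hK
  let φ' : Module.End A M := K.subtype ∘ₗ φ
  have hφK : ∀ x, φ' x ∈ K := fun x => (φ x).2
  -- `h φ` is an endomorphism `ψ` of `M` with image in `N'`
  let ψ : Module.End A M := (LinearEquiv.ofInjective j hj).symm.toLinearMap ∘ₗ
    (h ∘ₗ j ∘ₗ φ').codRestrict _ fun x => hKM _ (hφK x)
  have hψ : ∀ x, j (ψ x) = h (j (φ' x)) := fun x => congrArg Subtype.val
    ((LinearEquiv.ofInjective j hj).apply_symm_apply ⟨h (j (φ' x)), hKM _ (hφK x)⟩)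
  have hφ0 : j ∘ₗ φ' = 0 := by
    refine hM.eq_zero_of_isEssential_ker_of_hom hj hess (hsum.mono (sup_le ?_ ?_))
    · intro x hx
      have hψx : ψ x = 0 := hNN' _ (hinvN ψ hx) ((hmemN' _).mpr (by rw [hψ, heh]))
      have : φ' x = 0 := hKinj _ (hφK x) (by rw [← hψ, hψx, map_zero])
      simp [this]
    · intro x hx
      have : φ' x = 0 := hNN' _ (hKN (hφK x)) (hinvN' φ' hx)
      simp [this]
  refine hφ (LinearMap.ext fun x => Subtype.ext (hj ?_))
  exact (LinearMap.congr_fun hφ0 x).trans (map_zero j).symm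

end Polyform

/-! ### The trace in an injective hull -/

section Trace

variable {A : Type u} [Ring A] {M : Type v} [AddCommGroup M] [Module A M]
  {E : Type (max u v)} [AddCommGroup E] [Module A E]

theorem mem_trace (φ : M →ₗ[A] E) (x : M) : φ x ∈ trace A M E :=
  Submodule.mem_iSup_of_mem φ ⟨x, rfl⟩

theorem isQuasiInjective_trace (hE : Module.Injective A E) :
    IsQuasiInjective A (trace A M E) := by
  intro K f
  obtain ⟨g, hg⟩ := hE.out ((trace A M E).subtype ∘ₗ K.subtype)
    ((trace A M E).injective_subtype.comp K.injective_subtype) ((trace A M E).subtype ∘ₗ f)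
  have hle : trace A M E ≤ (trace A M E).comap g := iSup_le fun φ => by
    rintro _ ⟨x, rfl⟩
    exact mem_trace (g ∘ₗ φ) x
  exact ⟨g.restrict hle, fun x => Subtype.ext (hg x)⟩

/-- The trace of `M` is generated by `M`: an endomorphism that kills the image of every
homomorphism from `M` is zero. -/
theorem eq_zero_of_forall_comp_eq_zero (g : Module.End A (trace A M E))
    (hg : ∀ φ : M →ₗ[A] trace A M E, g ∘ₗ φ = 0) : g = 0 := by
  have hle : trace A M E ≤ (LinearMap.ker g).map (trace A M E).subtype := iSup_le fun φ => by
    rintro _ ⟨x, rfl⟩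
    exact ⟨⟨φ x, mem_trace φ x⟩,
      LinearMap.congr_fun (hg (φ.codRestrict _ (mem_trace φ))) x, rfl⟩
  ext x
  obtain ⟨y, hy, hyx⟩ := hle x.2
  rw [← Subtype.ext hyx, LinearMap.mem_ker.mp hy, LinearMap.zero_apply]

end Trace

end AbelianEndoregular

theorem mainTheorem4 {R : Type u} [Ring R] {M : Type v} [AddCommGroup M] [Module Rᵐᵒᵖ M]
    {E : Type (max u v)} [AddCommGroup E] [Module Rᵐᵒᵖ E] (ι : M →ₗ[Rᵐᵒᵖ] E)
    (hE : AbelianEndoregular.IsInjectiveHull ι) :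
    (AbelianEndoregular.IsAbelianEndoregular Rᵐᵒᵖ (AbelianEndoregular.trace Rᵐᵒᵖ M E) →
      AbelianEndoregular.IsPolyform Rᵐᵒᵖ M ∧
      (∀ N : Submodule Rᵐᵒᵖ M,
        AbelianEndoregular.IsEssentiallyClosed N → N.IsFullyInvariant) ∧
      IsReduced (Module.End Rᵐᵒᵖ M)) ∧
    (AbelianEndoregular.IsRetractable Rᵐᵒᵖ M →
      AbelianEndoregular.IsPolyform Rᵐᵒᵖ M ∧
      (∀ N : Submodule Rᵐᵒᵖ M,
        AbelianEndoregular.IsEssentiallyClosed N → N.IsFullyInvariant) ∧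
      IsReduced (Module.End Rᵐᵒᵖ M) →
      AbelianEndoregular.IsAbelianEndoregular Rᵐᵒᵖ (AbelianEndoregular.trace Rᵐᵒᵖ M E)) := by
  let j : M →ₗ[Rᵐᵒᵖ] AbelianEndoregular.trace Rᵐᵒᵖ M E :=
    ι.codRestrict _ (AbelianEndoregular.mem_trace ι)
  have hj : Function.Injective j := fun x y h => hE.embedding (congrArg Subtype.val h)
  have hess : AbelianEndoregular.IsEssential (LinearMap.range j) := by
    have h := hE.essential.comap (AbelianEndoregular.trace Rᵐᵒᵖ M E).subtype
    refine h.mono ?_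
    rintro x ⟨m, hm⟩
    exact ⟨m, Subtype.ext hm⟩
  have hT := AbelianEndoregular.isQuasiInjective_trace (M := M) hE.injective
  refine ⟨fun ⟨hreg, hab⟩ => ?_, fun hret ⟨hM, hclosed, _⟩ => ?_⟩
  · have hns := hreg.isKNonsingular
    exact ⟨AbelianEndoregular.isPolyform_of_isQuasiInjective hT hns hj,
      fun N hN => hN.isFullyInvariant hT hns hab hj hess,
      AbelianEndoregular.isReduced_end_of_isQuasiInjective hT hreg hab hj hess⟩
  · have hns := hM.isKNonsingular hj hess AbelianEndoregular.eq_zero_of_forall_comp_eq_zero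
    exact ⟨hT.isVonNeumannRegular_end hns,
      AbelianEndoregular.isAbelian_of_one_sub_mul_mul_eq_zero fun e he f =>
        hM.one_sub_mul_mul_eq_zero hret hclosed hj hess hns he f⟩
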